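/- **Lemma 4.3.** There is an absolute constant $c>0$ such that, for $m = 10^9 n$ and $M$ uniformly random in $\mathbb{F}_2^{m\times n}$, the following holds with probability $1-o(1)$ as $n\to\infty$. Every cell-probe data structure for $M$ with space $s\le 1.01\,n$ whose answer to each query $i\in[m]$ is correct with probability at least $2/3$ has query time $$t \;\ge\; c\,\log_2 n .$$ Here a deterministic cell-probe data structure with space $s$ and query time $t$ consists of an arbitrary preprocessing map $U:\mathbb{F}_2^n\to\{0,1\}^s$ (the memory consists of $s$ cells of one bit each) and, for each $i\in[m]$, an adaptive query algorithm (a decision tree) that probes at most $t$ cells of $U(x)$ and outputs an element of $\mathbb{F}_2$; both may depend arbitrarily on $M$. A data structure may also be randomized, that is, drawn from a probability distribution on such deterministic data structures. Its answer to query $i$ is correct with probability at least $2/3$ if, for $x\in\mathbb{F}_2^n$ uniformly random and independent of the internal randomness, the output equals $(Mx)_i=\langle M_i,x\rangle$ with probability at least $2/3$. -/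

import Mathlib

open Filter Topology
open scoped ENNReal

/-- An adaptive probing algorithm (decision tree) on a memory of `s` one-bit cells: at a leaf it
announces its answer, at an inner node it probes the cell `j` and continues with the subtree
`next b`, where `b` is the bit found in that cell. -/
inductive ProbeTree (s : ℕ) : Type
  | leaf (answer : ZMod 2) : ProbeTree s
  | probe (j : Fin s) (next : Bool → ProbeTree s) : ProbeTree s

/-- The number of probes made in the worst case. -/
def ProbeTree.depth {s : ℕ} : ProbeTree s → ℕ
  | .leaf _ => 0
  | .probe _ next => 1 + max (next false).depth (next true).depth

/-- The answer of the probing algorithm on the memory content `u`. -/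
def ProbeTree.run {s : ℕ} (u : Fin s → Bool) : ProbeTree s → ZMod 2
  | .leaf a => a
  | .probe j next => (next (u j)).run u

/-- A (deterministic) static cell-probe data structure with space `s`, for inputs in `𝔽₂ⁿ` and
queries in `[m]`: an arbitrary preprocessing of the input into `s` one-bit cells, and for each
query an adaptive probing algorithm. -/
structure CellProbeDS (n m s : ℕ) : Type where
  preprocess : (Fin n → ZMod 2) → (Fin s → Bool)
  query : Fin m → ProbeTree s

/-- The answer to the query `i` on the input `x`. -/
def CellProbeDS.answer {n m s : ℕ} (D : CellProbeDS n m s) (i : Fin m) (x : Fin n → ZMod 2) :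
    ZMod 2 :=
  (D.query i).run (D.preprocess x)

/-- Every query makes at most `t` probes. -/
def CellProbeDS.ProbesAtMost {n m s : ℕ} (D : CellProbeDS n m s) (t : ℕ) : Prop :=
  ∀ i : Fin m, (D.query i).depth ≤ t

/-- The probability of the event `S` under the uniform distribution on a finite type. -/
noncomputable def uniformProb {α : Type*} [Fintype α] (S : Set α) : ℝ≥0∞ :=
  (S.ncard : ℝ≥0∞) / (Fintype.card α : ℝ≥0∞)

/-- A randomized data structure is a probability distribution `P` on deterministic ones.  This is
the probability, over a data structure drawn from `P` and an independent uniform input `x`, that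
the query `i` is answered by the `i`-th output `(M x)_i` of the linear operator `M`. -/
noncomputable def successProb {n m s : ℕ} (M : Matrix (Fin m) (Fin n) (ZMod 2))
    (P : PMF (CellProbeDS n m s)) (i : Fin m) : ℝ≥0∞ :=
  ∑' D : CellProbeDS n m s, P D * uniformProb {x : Fin n → ZMod 2 | D.answer i x = M.mulVec x i}

/-- `τ` is a lower bound for the number of probes of every (possibly randomized) cell-probe data
structure for `M` that uses at most `σ` cells and answers each query correctly with probability
at least `2/3`. -/
def ProbeLowerBound {n m : ℕ} (M : Matrix (Fin m) (Fin n) (ZMod 2)) (σ τ : ℝ) : Prop :=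
  ∀ s t : ℕ, (s : ℝ) ≤ σ →
    ∀ P : PMF (CellProbeDS n m s),
      (∀ D ∈ P.support, D.ProbesAtMost t) →
      (∀ i : Fin m, 2 / 3 ≤ successProb M P i) →
      τ ≤ (t : ℝ)

/-! The proof is a union bound over matrices `M`. Averaging yields a deterministic structure with
more than 13/20 of its answers right, so by Markov an eighth of the inputs `x` have `M x` within
distance 2m/5 of an answer vector (`two_pow_le_card_close`). These inputs contain n - 3 vectors of a
basis (`exists_spanning_mem`). For fixed trees the answer vector depends only on the memory, so
whatever the preprocessing, at most 2^s 29^(m/5) of the 32^(m/5) vectors are near one. A uniform `M`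
maps a basis to independent uniform vectors, so all n - 3 images land there with probability
2^(-Ω(mn)). This beats the number of bases, subsets and tree families, the last being at most
2^(mn/1000) when t ≤ (log₂ n)/2. -/

/-! ### Counting decision trees -/

/-- The functions on `s` bits that a decision tree of depth at most `t` can compute. -/
def treeFunctions (s : ℕ) : ℕ → Finset ((Fin s → Bool) → ZMod 2)
  | 0 => Finset.univ.image fun a _ => a
  | t + 1 => (Finset.univ.image fun a _ => a) ∪
      (Finset.univ ×ˢ treeFunctions s t ×ˢ treeFunctions s t).image
        fun p u => if u p.1 then p.2.1 u else p.2.2 u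

theorem ProbeTree.run_mem_treeFunctions {s : ℕ} (T : ProbeTree s) (t : ℕ) (h : T.depth ≤ t) :
    (fun u => T.run u) ∈ treeFunctions s t := by
  induction t generalizing T with
  | zero =>
    cases T with
    | leaf a => simp [treeFunctions, ProbeTree.run]
    | probe j next => simp [ProbeTree.depth] at h
  | succ t ih =>
    cases T with
    | leaf a =>
      simp only [treeFunctions, Finset.mem_union, Finset.mem_image, Finset.mem_univ, true_and]
      exact Or.inl ⟨a, rfl⟩
    | probe j next =>
      simp only [ProbeTree.depth] at h
      have h1 := ih (next true) (by omega)
      have h2 := ih (next false) (by omega)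
      simp only [treeFunctions, Finset.mem_union, Finset.mem_image]
      refine Or.inr ⟨(j, _, _), Finset.mk_mem_product (Finset.mem_univ _)
        (Finset.mk_mem_product h1 h2), ?_⟩
      funext u
      cases hu : u j <;> simp [ProbeTree.run, hu]

/-- The count satisfies a(t+1) ≤ 2 + s a(t)² ≤ (s+2) a(t)²; with the extra factor s + 2 each level
is a plain squaring. -/
theorem card_treeFunctions_mul_le (s t : ℕ) :
    (treeFunctions s t).card * (s + 2) ≤ (s + 2) ^ 2 ^ (t + 1) := by
  have hconst : (Finset.univ.image fun (a : ZMod 2) (_ : Fin s → Bool) => a).card ≤ 2 :=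
    Finset.card_image_le.trans (by simp [ZMod.card])
  induction t with
  | zero =>
    simp only [treeFunctions]
    norm_num
    nlinarith
  | succ t ih =>
    have h1 : (treeFunctions s (t + 1)).card ≤ 2 + s * (treeFunctions s t).card ^ 2 := by
      refine (Finset.card_union_le _ _).trans (Nat.add_le_add hconst ?_)
      refine Finset.card_image_le.trans ?_
      simp [sq]
    have hpos : 1 ≤ (treeFunctions s t).card :=
      Finset.card_pos.2 ⟨_, (ProbeTree.leaf 0 : ProbeTree s).run_mem_treeFunctions t
        (Nat.zero_le _)⟩
    have hsq : 1 ≤ (treeFunctions s t).card ^ 2 := Nat.one_le_pow _ _ hpos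
    calc (treeFunctions s (t + 1)).card * (s + 2)
        ≤ ((s + 2) * (treeFunctions s t).card ^ 2) * (s + 2) := by
          gcongr
          nlinarith
      _ = ((treeFunctions s t).card * (s + 2)) ^ 2 := by ring
      _ ≤ ((s + 2) ^ 2 ^ (t + 1)) ^ 2 := by gcongr
      _ = (s + 2) ^ 2 ^ (t + 1 + 1) := by rw [← pow_mul, ← pow_succ]

theorem card_treeFunctions_le (s t : ℕ) :
    (treeFunctions s t).card ≤ (s + 2) ^ 2 ^ (t + 1) :=
  (Nat.le_mul_of_pos_right _ (by omega)).trans (card_treeFunctions_mul_le s t)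

/-! ### Hamming balls around answer vectors -/

theorem sum_pow_hammingDist {m : ℕ} (l : ℝ) (c : Fin m → ZMod 2) :
    ∑ y : Fin m → ZMod 2, l ^ hammingDist y c = (1 + l) ^ m := by
  have h : ∀ y : Fin m → ZMod 2, l ^ hammingDist y c = ∏ i, if y i ≠ c i then l else 1 := by
    intro y
    rw [hammingDist, Finset.prod_ite]
    simp
  have hc : ∀ a : ZMod 2, (∑ x : ZMod 2, if x ≠ a then l else 1) = 1 + l := by
    intro a
    rw [← Finset.add_sum_erase _ _ (Finset.mem_univ a), Finset.sum_congr rfl fun x hx =>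
      if_pos (Finset.ne_of_mem_erase hx)]
    simp [Finset.card_erase_of_mem, ZMod.card]
  simp_rw [h]
  rw [← Fintype.piFinset_univ,
    ← Finset.prod_univ_sum (fun _ => Finset.univ) (fun i a => if a ≠ c i then l else 1)]
  simp_rw [hc]
  simp

/-- A Chernoff-type bound for the volume of the Hamming ball of relative radius `2/5`. -/
theorem card_hammingBall_le (q : ℕ) (c : Fin (5 * q) → ZMod 2) :
    ((Finset.univ.filter fun y => hammingDist y c ≤ 2 * q).card : ℝ) ≤ 29 ^ q := by
  -- The weight 2/3 = (2/5)/(3/5) is the optimal one for radius 2/5; (5/3)^5 / (2/3)^2 = 28.9… gives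
  -- the 29.
  have h1 : ((Finset.univ.filter fun y => hammingDist y c ≤ 2 * q).card : ℝ) * (2 / 3) ^ (2 * q) ≤
      (1 + 2 / 3) ^ (5 * q) := by
    rw [← sum_pow_hammingDist (2 / 3) c, ← nsmul_eq_mul]
    refine (Finset.card_nsmul_le_sum _ (fun y => (2 / 3 : ℝ) ^ hammingDist y c) _ ?_).trans
      (Finset.sum_le_univ_sum_of_nonneg fun y => by positivity)
    intro y hy
    exact pow_le_pow_of_le_one (by norm_num) (by norm_num) (Finset.mem_filter.1 hy).2
  have h2 : ((1 + 2 / 3 : ℝ)) ^ (5 * q) ≤ 29 ^ q * (2 / 3) ^ (2 * q) := by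
    rw [pow_mul, pow_mul, ← mul_pow]
    gcongr
    norm_num
  exact le_of_mul_le_mul_right (h1.trans h2) (by positivity)

/-- The vectors within relative Hamming distance `2/5` of some answer vector of `F`. -/
def nearAnswers {q s : ℕ} (F : Fin (5 * q) → (Fin s → Bool) → ZMod 2) :
    Finset (Fin (5 * q) → ZMod 2) :=
  Finset.univ.biUnion fun u => Finset.univ.filter fun y => hammingDist y (fun i => F i u) ≤ 2 * q

theorem card_nearAnswers_le {q s : ℕ} (F : Fin (5 * q) → (Fin s → Bool) → ZMod 2) :
    ((nearAnswers F).card : ℝ) ≤ 2 ^ s * 29 ^ q := by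
  have h : ((nearAnswers F).card : ℝ) ≤ ∑ u : Fin s → Bool,
      ((Finset.univ.filter fun y => hammingDist y (fun i => F i u) ≤ 2 * q).card : ℝ) := by
    exact_mod_cast Finset.card_biUnion_le
  refine h.trans ((Finset.sum_le_card_nsmul _ _ _ fun u _ => card_hammingBall_le q _).trans ?_)
  simp

/-! ### Matrices and bases -/

/-- A matrix is determined by its values on a spanning family, and only those indexed by `J` are
constrained. -/
theorem card_mulVec_mem_le {m n : ℕ} (b : Fin n → Fin n → ZMod 2)
    (hb : Submodule.span (ZMod 2) (Set.range b) = ⊤) (J : Finset (Fin n))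
    (B : Finset (Fin m → ZMod 2)) :
    (Finset.univ.filter fun M : Matrix (Fin m) (Fin n) (ZMod 2) =>
      ∀ i ∈ J, M.mulVec (b i) ∈ B).card ≤ B.card ^ J.card * (2 ^ m) ^ (n - J.card) := by
  have hcard : (Fintype.piFinset fun i => if i ∈ J then B else Finset.univ).card =
      B.card ^ J.card * (2 ^ m) ^ (n - J.card) := by
    have h : ∀ i, (if i ∈ J then B else Finset.univ).card =
        if i ∈ J then B.card else 2 ^ m := by
      intro i
      split_ifs <;> simp [ZMod.card]
    rw [Fintype.card_piFinset]
    simp_rw [h]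
    rw [Finset.prod_ite]
    simp [Finset.filter_not, Finset.card_sdiff]
  rw [← hcard]
  refine Finset.card_le_card_of_injOn (fun M i => M.mulVec (b i)) ?_ ?_
  · intro M hM
    have hM := (Finset.mem_filter.1 hM).2
    simp only [Finset.mem_coe, Fintype.mem_piFinset]
    intro i
    by_cases hi : i ∈ J
    · simpa [hi] using hM i hi
    · simp [hi]
  · intro M _ N _ h
    have h' : Matrix.mulVecLin M = Matrix.mulVecLin N :=
      LinearMap.ext_on_range hb fun i => congrFun h i
    exact Matrix.toLin'.injective h'

/-- A set of at least `2 ^ n / 8` vectors contains all but three vectors of some basis. -/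
theorem exists_spanning_mem {n : ℕ} (G : Finset (Fin n → ZMod 2)) (hG : 2 ^ n ≤ 8 * G.card) :
    ∃ b : Fin n → Fin n → ZMod 2, Submodule.span (ZMod 2) (Set.range b) = ⊤ ∧
      ∃ J : Finset (Fin n), J.card = n - 3 ∧ ∀ i ∈ J, b i ∈ G := by
  classical
  obtain ⟨v, hvG, hspan, hv⟩ := exists_linearIndependent (ZMod 2) (G : Set (Fin n → ZMod 2))
  have hv : LinearIndepOn (ZMod 2) id v := hv
  let e := Module.Basis.extend hv
  have hfin : Fintype (hv.extend (Set.subset_univ v)) := Fintype.ofFinite _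
  have hc : Fintype.card (hv.extend (Set.subset_univ v)) = Fintype.card (Fin n) := by
    rw [← Module.finrank_eq_card_basis e]
    simp
  let σ := Fintype.equivOfCardEq hc
  have hvc : n - 3 ≤ v.ncard := by
    have h1 : Module.finrank (ZMod 2) (Submodule.span (ZMod 2) v) = v.ncard := by
      have : Fintype v := Fintype.ofFinite _
      rw [finrank_span_set_eq_card hv, Set.ncard_eq_toFinset_card']
    -- `G` lies in the span of its maximal independent subset `v`.
    have h2 : G.card ≤ 2 ^ v.ncard := by
      have h3 : Nat.card (Submodule.span (ZMod 2) v) = 2 ^ v.ncard := by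
        rw [Module.natCard_eq_pow_finrank (K := ZMod 2), h1]
        simp
      rw [← h3, ← Set.ncard_coe_finset]
      refine Set.ncard_le_ncard (t := (Submodule.span (ZMod 2) v : Set (Fin n → ZMod 2))) ?_
      rw [hspan]
      exact Submodule.subset_span
    have h4 : 2 ^ n ≤ 2 ^ (3 + v.ncard) := by
      rw [pow_add]
      omega
    have := (Nat.pow_le_pow_iff_right (by norm_num : 1 < 2)).1 h4
    omega
  refine ⟨fun i => (e.reindex σ) i, (e.reindex σ).span_eq, ?_⟩
  have hJ : n - 3 ≤ (Finset.univ.filter fun i => (e.reindex σ) i ∈ G).card := by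
    refine hvc.trans ?_
    rw [← Set.ncard_coe_finset, ← Set.ncard_image_of_injective _ (e.reindex σ).injective]
    refine Set.ncard_le_ncard ?_
    intro x hx
    refine ⟨σ ⟨x, hv.subset_extend _ hx⟩, ?_, ?_⟩
    · have : x ∈ G := hvG hx
      simpa [e] using this
    · simp [e]
  obtain ⟨J, hJs, hJc⟩ := Finset.exists_subset_card_eq hJ
  exact ⟨J, hJc, fun i hi => (Finset.mem_filter.1 (hJs hi)).2⟩

/-! ### From data structures to close matrices -/

/-- Some structure does at least as well as the average; 13/20 < 2/3 leaves room for a strict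
inequality. -/
theorem exists_mem_support_sum_card_gt {n m s : ℕ} (hm : 0 < m)
    (M : Matrix (Fin m) (Fin n) (ZMod 2)) (P : PMF (CellProbeDS n m s))
    (hP : ∀ i, 2 / 3 ≤ successProb M P i) :
    ∃ D ∈ P.support, 13 * m * 2 ^ n <
      20 * ∑ i, (Finset.univ.filter fun x => D.answer i x = M.mulVec x i).card := by
  by_contra! hD
  have hbound : ∀ D ∈ P.support,
      ∑ i, uniformProb {x : Fin n → ZMod 2 | D.answer i x = M.mulVec x i} ≤
        (13 * m : ℝ≥0∞) / 20 := by
    intro D hDs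
    have h := hD D hDs
    have hcard : (Fintype.card (Fin n → ZMod 2) : ℝ≥0∞) = 2 ^ n := by simp [ZMod.card]
    simp only [uniformProb, hcard, div_eq_mul_inv]
    rw [← Finset.sum_mul, ← div_eq_mul_inv]
    refine ENNReal.div_le_of_le_mul ?_
    rw [← div_eq_mul_inv, ENNReal.mul_comm_div, mul_div_assoc',
      ENNReal.le_div_iff_mul_le (by simp) (by simp)]
    have h' : ((20 * ∑ i, (Finset.univ.filter fun x => D.answer i x = M.mulVec x i).card : ℕ) :
        ℝ≥0∞) ≤ ((13 * m * 2 ^ n : ℕ) : ℝ≥0∞) := by exact_mod_cast h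
    push_cast at h'
    rw [mul_comm]
    convert h' using 3 with i
    rw [← Set.ncard_coe_finset]
    simp
  have h1 : (m : ℝ≥0∞) * (2 / 3) ≤ (13 * m : ℝ≥0∞) / 20 := by
    calc (m : ℝ≥0∞) * (2 / 3) = ∑ _i : Fin m, (2 / 3 : ℝ≥0∞) := by simp
      _ ≤ ∑ i, successProb M P i := Finset.sum_le_sum fun i _ => hP i
      _ = ∑' D, P D * ∑ i, uniformProb {x : Fin n → ZMod 2 | D.answer i x = M.mulVec x i} := by
        simp only [successProb, Finset.mul_sum]
        rw [Summable.tsum_finsetSum fun _ _ => ENNReal.summable]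
      _ ≤ ∑' D, P D * ((13 * m : ℝ≥0∞) / 20) := by
        refine ENNReal.tsum_le_tsum fun D => ?_
        by_cases h : D ∈ P.support
        · gcongr
          exact hbound D h
        · rw [(P.apply_eq_zero_iff D).2 h]
          simp
      _ = (13 * m : ℝ≥0∞) / 20 := by rw [ENNReal.tsum_mul_right, P.tsum_coe, one_mul]
  have h2 := ENNReal.toReal_mono (by finiteness) h1
  simp only [ENNReal.toReal_mul, ENNReal.toReal_div, ENNReal.toReal_natCast,
    ENNReal.toReal_ofNat] at h2
  have : (0 : ℝ) < m := by exact_mod_cast hm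
  linarith

/-- If a data structure answers correctly with probability more than `13/20` on average, then for
at least an eighth of the inputs at most `2/5` of the answers are wrong. -/
theorem two_pow_le_card_close {n q : ℕ} (A M : (Fin n → ZMod 2) → Fin (5 * q) → ZMod 2)
    (h : 13 * (5 * q) * 2 ^ n < 20 * ∑ i, (Finset.univ.filter fun x => A x i = M x i).card) :
    2 ^ n ≤ 8 * (Finset.univ.filter fun x => hammingDist (M x) (A x) ≤ 2 * q).card := by
  have hcard : Fintype.card (Fin n → ZMod 2) = 2 ^ n := by simp [ZMod.card]
  have hsum : ∑ x, hammingDist (M x) (A x) =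
      ∑ i, (Finset.univ.filter fun x => ¬ A x i = M x i).card := by
    simp only [hammingDist, Finset.card_filter]
    rw [Finset.sum_comm]
    simp only [ne_comm, ne_eq]
  have htot : ∑ i, (Finset.univ.filter fun x => A x i = M x i).card +
      ∑ i, (Finset.univ.filter fun x => ¬ A x i = M x i).card = 5 * q * 2 ^ n := by
    rw [← Finset.sum_add_distrib]
    simp only [Finset.card_filter_add_card_filter_not]
    simp [hcard]
  -- Markov: the bad fraction is below (7/20)/(2/5) = 7/8.
  have hW : (Finset.univ.filter fun x => ¬ hammingDist (M x) (A x) ≤ 2 * q).card * (2 * q) ≤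
      ∑ x, hammingDist (M x) (A x) := by
    rw [← smul_eq_mul]
    refine (Finset.card_nsmul_le_sum _ (fun x => hammingDist (M x) (A x)) _ ?_).trans
      (Finset.sum_le_univ_sum_of_nonneg fun _ => Nat.zero_le _)
    intro x hx
    have := (Finset.mem_filter.1 hx).2
    omega
  have hG := Finset.card_filter_add_card_filter_not (s := Finset.univ)
    (fun x => hammingDist (M x) (A x) ≤ 2 * q)
  rw [Finset.card_univ, hcard] at hG
  by_contra! hlt
  nlinarith

/-- The matrices for which some basis has all but three of its vectors mapped close to answer
vectors of a family of depth-`t` decision trees on `s` bits. -/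
noncomputable def closeMatrices (q n s t : ℕ) : Finset (Matrix (Fin (5 * q)) (Fin n) (ZMod 2)) :=
  by
    classical
    exact (Fintype.piFinset fun _ => treeFunctions s t).biUnion fun F =>
      (Finset.univ.filter fun b : Fin n → Fin n → ZMod 2 =>
        Submodule.span (ZMod 2) (Set.range b) = ⊤).biUnion fun b =>
      (Finset.univ.filter fun J : Finset (Fin n) => J.card = n - 3).biUnion fun J =>
      Finset.univ.filter fun M => ∀ i ∈ J, M.mulVec (b i) ∈ nearAnswers F

theorem card_closeMatrices_le (q n s t : ℕ) (hn : 3 ≤ n) :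
    (closeMatrices q n s t).card ≤ ((s + 2) ^ 2 ^ (t + 1)) ^ (5 * q) *
      (2 ^ (n * n) * (2 ^ n * ((2 ^ s * 29 ^ q) ^ (n - 3) * (2 ^ (5 * q)) ^ 3))) := by
  classical
  unfold closeMatrices
  refine (Finset.card_biUnion_le_card_mul _ _ _ fun F _ =>
    (Finset.card_biUnion_le_card_mul _ _ _ fun b hb =>
    (Finset.card_biUnion_le_card_mul _ _ _ fun J hJ => ?_).trans
      (Nat.mul_le_mul_right _ ?_)).trans (Nat.mul_le_mul_right _ ?_)).trans
      (Nat.mul_le_mul_right _ ?_)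
  · have hJ' : J.card = n - 3 := (Finset.mem_filter.1 hJ).2
    refine (card_mulVec_mem_le b (Finset.mem_filter.1 hb).2 J (nearAnswers F)).trans ?_
    rw [hJ', show n - (n - 3) = 3 by omega]
    have : (nearAnswers F).card ≤ 2 ^ s * 29 ^ q := by exact_mod_cast card_nearAnswers_le F
    gcongr
  · refine (Finset.card_filter_le _ _).trans ?_
    simp
  · refine (Finset.card_filter_le _ _).trans ?_
    simp [ZMod.card, pow_mul]
  · rw [Fintype.card_piFinset]
    simp only [Finset.prod_const, Finset.card_univ, Fintype.card_fin]
    exact Nat.pow_le_pow_left (card_treeFunctions_le s t) _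

theorem mem_closeMatrices_of_successProb {q n s t : ℕ} (hq : 0 < q)
    (M : Matrix (Fin (5 * q)) (Fin n) (ZMod 2)) (P : PMF (CellProbeDS n (5 * q) s))
    (hPt : ∀ D ∈ P.support, D.ProbesAtMost t) (hP : ∀ i, 2 / 3 ≤ successProb M P i) :
    M ∈ closeMatrices q n s t := by
  classical
  obtain ⟨D, hD, hsum⟩ := exists_mem_support_sum_card_gt (by omega) M P hP
  obtain ⟨b, hb, J, hJ, hbJ⟩ := exists_spanning_mem _
    (two_pow_le_card_close (fun x i => D.answer i x) M.mulVec hsum)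
  simp only [closeMatrices, Finset.mem_biUnion]
  refine ⟨fun i u => (D.query i).run u, Fintype.mem_piFinset.2 fun i =>
    (D.query i).run_mem_treeFunctions t (hPt D hD i), b,
    Finset.mem_filter.2 ⟨Finset.mem_univ _, hb⟩, J,
    Finset.mem_filter.2 ⟨Finset.mem_univ _, hJ⟩, Finset.mem_filter.2 ⟨Finset.mem_univ _, ?_⟩⟩
  intro i hi
  exact Finset.mem_biUnion.2 ⟨D.preprocess (b i), Finset.mem_univ _,
    Finset.mem_filter.2 ⟨Finset.mem_univ _, (Finset.mem_filter.1 (hbJ i hi)).2⟩⟩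

/-! ### Arithmetic and conclusion -/

/-- The arithmetic behind the union bound. -/
theorem unionBound_mul_le (n r K : ℕ) (hn : 6 ≤ n) (hr : r = 25000000 * n)
    (hK : K ^ 1000 ≤ 2 ^ n) :
    (2 * n + 1) * (K ^ (5 * (8 * r)) * (2 ^ (n * n) * (2 ^ n *
      ((2 ^ (2 * n) * 29 ^ (8 * r)) ^ (n - 3) * (2 ^ (5 * (8 * r))) ^ 3)))) * 2 ^ n ≤
      2 ^ (5 * (8 * r) * n) := by
  obtain ⟨k, rfl⟩ : ∃ k, n = k + 3 := ⟨n - 3, by omega⟩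
  generalize hN : k + 3 = N at *
  have hk : N - 3 = k := by omega
  rw [hk]
  have h1 : 2 * N + 1 ≤ 2 ^ (2 * N) :=
    Nat.lt_two_pow_self
  have h2 : K ^ (5 * (8 * r)) ≤ 2 ^ (N * (1000000 * N)) := by
    rw [show 5 * (8 * r) = 1000 * (1000000 * N) by omega, pow_mul K 1000, pow_mul 2 N]
    exact Nat.pow_le_pow_left hK _
  -- 2 · 29^8 ≤ 2^40: every 40 queries gain one bit, hence q = 8r.
  have h3 : 29 ^ (8 * r) * 2 ^ r ≤ 2 ^ (5 * (8 * r)) := by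
    rw [show 5 * (8 * r) = 40 * r by ring, pow_mul, pow_mul, ← mul_pow]
    exact Nat.pow_le_pow_left (by norm_num) _
  have h4 : (29 ^ (8 * r)) ^ k * 2 ^ (r * k) ≤ 2 ^ (5 * (8 * r) * k) := by
    rw [pow_mul 2 r, pow_mul 2 (5 * (8 * r)), ← mul_pow]
    exact Nat.pow_le_pow_left h3 _
  -- All losses, about 10^6 N² bits, against a gain of r k ≥ 12.5 · 10^6 N².
  have h5 : 2 * N + N * (1000000 * N) + N * N + N + 2 * N * k + N ≤ r * k := by
    rw [hr]
    have : N ≤ 2 * k := by omega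
    nlinarith
  refine le_of_mul_le_mul_right ?_ (show 0 < 2 ^ (r * k) by positivity)
  calc _ ≤ (2 ^ (2 * N)) * (2 ^ (N * (1000000 * N)) * (2 ^ (N * N) * (2 ^ N *
      ((2 ^ (2 * N) * 29 ^ (8 * r)) ^ k * (2 ^ (5 * (8 * r))) ^ 3)))) * 2 ^ N * 2 ^ (r * k) := by
        gcongr
    _ = 2 ^ (2 * N + N * (1000000 * N) + N * N + N + 2 * N * k + N) *
        ((29 ^ (8 * r)) ^ k * 2 ^ (r * k)) * (2 ^ (5 * (8 * r))) ^ 3 := by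
        rw [mul_pow, ← pow_mul 2 (2 * N) k]
        simp only [pow_add]
        ac_rfl
    _ ≤ 2 ^ (r * k) * 2 ^ (5 * (8 * r) * k) * (2 ^ (5 * (8 * r))) ^ 3 := by
        gcongr
        norm_num
    _ = 2 ^ (5 * (8 * r) * N) * 2 ^ (r * k) := by
        rw [← pow_mul, mul_assoc, ← pow_add, ← mul_add, hN, mul_comm]

/-- Since 2^t ≤ √n, the logarithm of the left side is O(√n log n). -/
theorem eventually_treeCount_pow_le :
    ∀ᶠ n : ℕ in atTop,
      ((2 * n + 2) ^ 2 ^ (⌊1 / 2 * Real.logb 2 (n : ℝ)⌋₊ + 1)) ^ 1000 ≤ 2 ^ n := by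
  have hlog : ∀ᶠ x : ℝ in atTop, Real.log x ≤ (Real.log 2 / 4000) * x ^ (1 / 2 : ℝ) := by
    have h := (isLittleO_log_rpow_atTop (r := 1 / 2) (by norm_num)).def
      (show 0 < Real.log 2 / 4000 by have := Real.log_pos one_lt_two; positivity)
    filter_upwards [h, eventually_ge_atTop 1] with x hx hx1
    rwa [Real.norm_of_nonneg (Real.log_nonneg hx1), Real.norm_of_nonneg (by positivity)] at hx
  filter_upwards [tendsto_natCast_atTop_atTop.eventually hlog, eventually_ge_atTop 3] with n hn hn3
  have hn0 : (0 : ℝ) < n := by positivity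
  have hn1 : (1 : ℝ) ≤ n := by exact_mod_cast (by omega : 1 ≤ n)
  have hl2 := Real.log_pos one_lt_two
  have hlogn : 0 ≤ Real.logb 2 n := Real.logb_nonneg one_lt_two hn1
  have hpow : (2 : ℝ) ^ ⌊1 / 2 * Real.logb 2 (n : ℝ)⌋₊ ≤ (n : ℝ) ^ (1 / 2 : ℝ) := by
    rw [← Real.rpow_natCast]
    refine (Real.rpow_le_rpow_of_exponent_le one_le_two (Nat.floor_le (by positivity))).trans ?_
    rw [mul_comm, Real.rpow_mul (by norm_num), Real.rpow_logb (by norm_num) (by norm_num) hn0]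
  have hsq : (n : ℝ) ^ (1 / 2 : ℝ) * (n : ℝ) ^ (1 / 2 : ℝ) = n := by
    rw [← Real.rpow_add hn0]
    norm_num
  rw [← Nat.cast_le (α := ℝ)]
  push_cast
  rw [← Real.log_le_log_iff (by positivity) (by positivity), Real.log_pow, Real.log_pow,
    Real.log_pow]
  have hbase : Real.log (2 * (n : ℝ) + 2) ≤ 2 * Real.log n := by
    have h3 : (3 : ℝ) ≤ n := by exact_mod_cast hn3
    rw [show (2 : ℝ) * Real.log n = Real.log ((n : ℝ) ^ 2) by rw [Real.log_pow]; norm_num]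
    exact Real.log_le_log (by positivity) (by nlinarith)
  push_cast
  rw [pow_succ]
  set L := Real.log 2
  set y := (n : ℝ) ^ (1 / 2 : ℝ)
  have hy : 0 ≤ y := by positivity
  calc (1000 : ℝ) * (2 ^ ⌊1 / 2 * Real.logb 2 (n : ℝ)⌋₊ * 2 * Real.log (2 * (n : ℝ) + 2))
      ≤ 1000 * (y * 2 * (2 * (L / 4000 * y))) := by
        have : Real.log (2 * (n : ℝ) + 2) ≤ 2 * (L / 4000 * y) := by linarith
        have h0 : 0 ≤ Real.log (2 * (n : ℝ) + 2) := Real.log_nonneg (by linarith)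
        gcongr
    _ = (y * y) * L := by ring
    _ = n * L := by rw [hsq]

theorem uniformProb_add_uniformProb_compl {α : Type*} [Fintype α] [Nonempty α] (S : Set α) :
    uniformProb S + uniformProb Sᶜ = 1 := by
  rw [uniformProb, uniformProb, ← ENNReal.add_div, ← Nat.cast_add, Set.ncard_add_ncard_compl,
    Nat.card_eq_fintype_card]
  exact ENNReal.div_self (by simp) (by simp)

theorem uniformProb_not_probeLowerBound_le {n m : ℕ} (hm : m = 5 * (8 * (25000000 * n)))
    (hn : 6 ≤ n)
    (hK : ((2 * n + 2) ^ 2 ^ (⌊1 / 2 * Real.logb 2 (n : ℝ)⌋₊ + 1)) ^ 1000 ≤ 2 ^ n) :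
    uniformProb {M : Matrix (Fin m) (Fin n) (ZMod 2) |
      ProbeLowerBound M (1.01 * (n : ℝ)) (1 / 2 * Real.logb 2 (n : ℝ))}ᶜ ≤ (2 ^ n)⁻¹ := by
  classical
  subst hm
  set t₀ := ⌊1 / 2 * Real.logb 2 (n : ℝ)⌋₊
  obtain ⟨r, hr⟩ : ∃ r, r = 25000000 * n := ⟨_, rfl⟩
  rw [← hr]
  have hsub : {M : Matrix (Fin (5 * (8 * r))) (Fin n) (ZMod 2) |
      ProbeLowerBound M (1.01 * (n : ℝ)) (1 / 2 * Real.logb 2 (n : ℝ))}ᶜ ⊆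
      ((Finset.range (2 * n + 1)).biUnion fun s => closeMatrices (8 * r) n s t₀ :
        Finset (Matrix (Fin (5 * (8 * r))) (Fin n) (ZMod 2))) := by
    intro M hM
    simp only [Set.mem_compl_iff, Set.mem_ofPred_eq, ProbeLowerBound, not_forall, not_le] at hM
    obtain ⟨s, t, hs, P, hPt, hP, ht⟩ := hM
    -- Only s ≤ 2n is needed; the union bound also runs over `s`.
    have hs' : s < 2 * n + 1 := by
      have : (s : ℝ) < 2 * n + 1 := by
        have : (0 : ℝ) ≤ n := by positivity
        linarith
      exact_mod_cast this
    rw [Finset.mem_coe, Finset.mem_biUnion]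
    refine ⟨s, Finset.mem_range.2 hs', mem_closeMatrices_of_successProb (by omega) M P
      (fun D hD i => (hPt D hD i).trans (Nat.le_floor ht.le)) hP⟩
  have hcard := (Set.ncard_le_ncard hsub).trans_eq (Set.ncard_coe_finset _)
  have hcard2 := hcard.trans (Finset.card_biUnion_le_card_mul _ _
    (((2 * n + 2) ^ 2 ^ (t₀ + 1)) ^ (5 * (8 * r)) * (2 ^ (n * n) * (2 ^ n *
      ((2 ^ (2 * n) * 29 ^ (8 * r)) ^ (n - 3) * (2 ^ (5 * (8 * r))) ^ 3)))) fun s hs => by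
    refine (card_closeMatrices_le (8 * r) n s t₀ (by omega)).trans ?_
    have : s ≤ 2 * n := by
      have := Finset.mem_range.1 hs
      omega
    gcongr
    norm_num)
  rw [Finset.card_range] at hcard2
  have hfinal := (Nat.mul_le_mul_right (2 ^ n) hcard2).trans
    (unionBound_mul_le n r _ hn hr hK)
  have hc : Fintype.card (Matrix (Fin (5 * (8 * r))) (Fin n) (ZMod 2)) =
      2 ^ (5 * (8 * r) * n) := by
    rw [← Nat.card_eq_fintype_card, Matrix, Nat.card_fun, Nat.card_fun]
    simp [← pow_mul, mul_comm]
  rw [uniformProb, hc]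
  refine ENNReal.div_le_of_le_mul ?_
  rw [← ENNReal.div_eq_inv_mul, ENNReal.le_div_iff_mul_le (by simp) (by simp)]
  exact_mod_cast hfinal

theorem lemma4p3 :
    ∃ c : ℝ, 0 < c ∧
      Tendsto
        (fun n : ℕ => uniformProb
          {M : Matrix (Fin (10 ^ 9 * n)) (Fin n) (ZMod 2) |
            ProbeLowerBound M (1.01 * (n : ℝ)) (c * Real.logb 2 (n : ℝ))})
        atTop (𝓝 1) := by
  refine ⟨1 / 2, by norm_num, ?_⟩
  have hlim : Tendsto (fun n : ℕ => 1 - ((2 : ℝ≥0∞) ^ n)⁻¹) atTop (𝓝 1) := by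
    have h : Tendsto (fun n : ℕ => ((2 : ℝ≥0∞) ^ n)⁻¹) atTop (𝓝 0) := by
      simp_rw [ENNReal.inv_pow]
      exact ENNReal.tendsto_pow_atTop_nhds_zero_of_lt_one (by simp)
    simpa using ENNReal.Tendsto.sub tendsto_const_nhds h (Or.inl ENNReal.one_ne_top)
  refine tendsto_of_tendsto_of_tendsto_of_le_of_le' hlim tendsto_const_nhds ?_ ?_
  · filter_upwards [eventually_treeCount_pow_le, eventually_ge_atTop 6] with n hK hn
    have hle := uniformProb_not_probeLowerBound_le (m := 10 ^ 9 * n) (by omega) hn hK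
    rw [tsub_le_iff_right,
      ← uniformProb_add_uniformProb_compl {M : Matrix (Fin (10 ^ 9 * n)) (Fin n) (ZMod 2) |
      ProbeLowerBound M (1.01 * (n : ℝ)) (1 / 2 * Real.logb 2 (n : ℝ))}]
    gcongr
  · refine Eventually.of_forall fun n => ?_
    rw [← uniformProb_add_uniformProb_compl {M : Matrix (Fin (10 ^ 9 * n)) (Fin n) (ZMod 2) |
      ProbeLowerBound M (1.01 * (n : ℝ)) (1 / 2 * Real.logb 2 (n : ℝ))}]
    exact le_self_add
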